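/- Let $q\ge 1$, $0<\alpha<1$, and let $f_X$ be a probability density on $\mathbb R$ with $\int x^{2q}f_X(x)\,dx<\infty$ that is symmetric, $f_X(-x)=f_X(x)$ for all $x$. A subsampling design $\xi$ is a measure on $\mathbb R$ of mass $\alpha$ with a density $f_\xi$ satisfying $0\le f_\xi\le f_X$. Put $\mathbf f(x)=(1,x,\dots,x^q)^\top$ and $\mathbf M(\xi)=\int \mathbf f(x)\mathbf f(x)^\top f_\xi(x)\,dx$. A design $\xi^*$ is $D$-optimal if it maximizes $\log\det\mathbf M(\xi)$ over all subsampling designs; write $\psi(x,\xi^*)=\alpha\,\mathbf f(x)^\top\mathbf M(\xi^*)^{-1}\mathbf f(x)$. Let $\xi^*$ be a $D$-optimal subsampling design. Then there are a threshold $s^*\in\mathbb R$, an integer $1\le r\le q$ and boundaries $a_1>a_2\ge a_3>a_4\ge\dots\ge a_{2r-1}>a_{2r}$ such that, with the disjoint intervals $\mathcal I_0=[a_1,\infty)$, $\mathcal I_k=[a_{2k+1},a_{2k}]$ for $1\le k\le r-1$, $\mathcal I_r=(-\infty,a_{2r}]$, and $\mathcal X^*=\bigcup_{k=0}^r\mathcal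 I_k$, 1. $f_{\xi^*}(x)=f_X(x)\mathbf 1_{\mathcal X^*}(x)=\sum_{k=0}^r f_X(x)\mathbf 1_{\mathcal I_k}(x)$ for almost every $x$, 2. $\psi(x,\xi^*)\ge s^*$ for all $x\in\mathcal X^*$, and 3. $\psi(x,\xi^*)<s^*$ for all $x\notin\mathcal X^*$. Moreover, for every such choice of $s^*$, $r$ and $a_1,\dots,a_{2r}$ the boundaries are symmetric about $0$: $a_{2r+1-k}=-a_k$ for $k=1,\dots,2r$ and, accordingly, $\mathcal I_{r-k}=-\mathcal I_k$ for $k=0,\dots,r$. -/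

import Mathlib

open MeasureTheory
open scoped Matrix Pointwise

namespace Subsampling

/-- The vector of regression functions `(1, x, …, x ^ q)` of polynomial regression of degree `q`. -/
def regressionVector (q : ℕ) (x : ℝ) : Fin (q + 1) → ℝ := fun j => x ^ (j : ℕ)

/-- `fX` is the density (with respect to Lebesgue measure) of a covariate
that has a finite moment of order `2 q`. -/
structure IsCovariateDensity (q : ℕ) (fX : ℝ → ℝ) : Prop where
  measurable : Measurable fX
  nonneg : ∀ x, 0 ≤ fX x
  integral_eq_one : ∫ x, fX x = 1
  integrable_moment : Integrable fun x => x ^ (2 * q) * fX x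

/-- `f` is the density of a continuous subsampling design: a measure of mass `α`
whose density is bounded by the density `fX` of the covariate. -/
structure IsSubsamplingDesign (fX : ℝ → ℝ) (α : ℝ) (f : ℝ → ℝ) : Prop where
  measurable : Measurable f
  nonneg : ∀ x, 0 ≤ f x
  le_covariate : ∀ x, f x ≤ fX x
  integral_eq : ∫ x, f x = α

/-- The information matrix `M(ξ) = ∫ f(x) f(x)ᵀ f_ξ(x) dx` of the design with density `f`. -/
noncomputable def informationMatrix (q : ℕ) (f : ℝ → ℝ) :
    Matrix (Fin (q + 1)) (Fin (q + 1)) ℝ :=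
  Matrix.of fun i j => ∫ x, regressionVector q x i * regressionVector q x j * f x

/-- `f` is the density of a `D`-optimal subsampling design: it maximizes `log det M(ξ)` among all
subsampling designs of mass `α` bounded by `fX`. -/
def IsDOptimal (q : ℕ) (fX : ℝ → ℝ) (α : ℝ) (f : ℝ → ℝ) : Prop :=
  IsSubsamplingDesign fX α f ∧
    ∀ g : ℝ → ℝ, IsSubsamplingDesign fX α g →
      Real.log (informationMatrix q g).det ≤ Real.log (informationMatrix q f).det

/-- The sensitivity function `ψ(x, ξ) = α f(x)ᵀ M(ξ)⁻¹ f(x)`. -/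
noncomputable def sensitivity (q : ℕ) (α : ℝ) (f : ℝ → ℝ) (x : ℝ) : ℝ :=
  α * (regressionVector q x ⬝ᵥ ((informationMatrix q f)⁻¹ *ᵥ regressionVector q x))

/-- The intervals `I₀ = [a₁, ∞)`, `I_k = [a_{2k+1}, a_{2k}]` for `0 < k < r`, and
`I_r = (-∞, a_{2r}]`; only `a 1, …, a (2 * r)` matter, and the intervals are used for
`r ≥ 1` and `k ≤ r`. -/
def supportInterval (r : ℕ) (a : ℕ → ℝ) (k : ℕ) : Set ℝ :=
  if k = 0 then Set.Ici (a 1)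
  else if k = r then Set.Iic (a (2 * r))
  else Set.Icc (a (2 * k + 1)) (a (2 * k))

/-- The support `X* = I₀ ∪ ⋯ ∪ I_r`. -/
def supportSet (r : ℕ) (a : ℕ → ℝ) : Set ℝ :=
  ⋃ k ∈ Finset.range (r + 1), supportInterval r a k

/-- The design with density `f` has threshold `s` and interval boundaries
`a 1 > a 2 ≥ a 3 > a 4 ≥ ⋯ > a (2 * r)`.
The intervals are mutually disjoint; an inner interval may consist of a single point, which
happens when the sensitivity function touches the threshold from below. -/
structure HasBoundaries (q : ℕ) (fX : ℝ → ℝ) (α : ℝ) (f : ℝ → ℝ)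
    (s : ℝ) (r : ℕ) (a : ℕ → ℝ) : Prop where
  one_le : 1 ≤ r
  le_degree : r ≤ q
  gap : ∀ k, 1 ≤ k → k ≤ r → a (2 * k) < a (2 * k - 1)
  inner : ∀ k, 1 ≤ k → k < r → a (2 * k + 1) ≤ a (2 * k)
  density : f =ᵐ[volume] (supportSet r a).indicator fX
  le_sensitivity : ∀ x ∈ supportSet r a, s ≤ sensitivity q α f x
  sensitivity_lt : ∀ x ∉ supportSet r a, sensitivity q α f x < s

end Subsampling

/-! Designs form a convex set, and at `M = M(ξ*)` the derivative of `det` towards `M(ξ)` is `det M *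
(tr (M⁻¹ M(ξ)) - (q + 1))`. Optimality therefore gives `tr (M⁻¹ M(ξ)) ≤ q + 1` for every design
(`IsDOptimal.trace_le`). Up to the factor `α` this trace is `∫ ψ f_ξ`, so `ξ*` maximizes the
integral of a fixed polynomial `ψ`. A bathtub argument (`IsSubsamplingDesign.exists_threshold`) then
forces `f = fX` on a superlevel set `{ψ ≥ s}` and `f = 0` off it, almost everywhere. As `ψ` has
degree `2q` and positive leading coefficient, `{ψ < s}` is bounded; it has at most `q` components
because a level slightly below `s` is attained twice in each (`exists_isChain_of_polynomial`).

For the symmetry, the reflection of `ξ*` is a design with the same determinant. The first order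
condition and the equality case of the AM-GM inequality (`eq_of_posDef_of_trace_inv_mul_le`) show
that it has the same information matrix, so `ψ` is even. In any admissible description the support
is `{ψ ≥ s}`, hence symmetric, and the support together with `r` determines the boundaries
(`IsChain.eq_of_supportSet_eq`). -/

namespace Subsampling

/-! ### Determinants and traces of positive definite matrices -/

/-- A positive definite matrix of determinant one whose trace is at most its size is the identity:
the equality case of the inequality between the arithmetic and the geometric mean. -/
theorem eq_one_of_posDef_of_det_eq_one {n : Type*} [Fintype n] [DecidableEq n]
    {A : Matrix n n ℝ} (hA : A.PosDef) (hdet : A.det = 1)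
    (htr : A.trace ≤ Fintype.card n) : A = 1 := by
  have hpos := hA.eigenvalues_pos
  have hdet' : ∏ i, hA.1.eigenvalues i = 1 := by
    rw [← hdet, hA.1.det_eq_prod_eigenvalues]; simp
  have htr' : ∑ i, (hA.1.eigenvalues i - 1) ≤ 0 := by
    rw [hA.1.trace_eq_sum_eigenvalues] at htr
    simpa using htr
  have hlog : ∑ i, Real.log (hA.1.eigenvalues i) = 0 := by
    rw [← Real.log_prod fun i _ => (hpos i).ne', hdet', Real.log_one]
  -- `log x < x - 1` unless `x = 1`, while the logarithms sum to `0` and the `x - 1` to at most `0`.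
  have hone : ∀ i, hA.1.eigenvalues i = 1 := by
    by_contra! h
    obtain ⟨i, hi⟩ := h
    have : ∑ i, Real.log (hA.1.eigenvalues i) < ∑ i, (hA.1.eigenvalues i - 1) :=
      Finset.sum_lt_sum (fun j _ => Real.log_le_sub_one_of_pos (hpos j))
        ⟨i, Finset.mem_univ i, Real.log_lt_sub_one_of_pos (hpos i) hi⟩
    linarith
  have hdiag : (Matrix.diagonal (RCLike.ofReal ∘ hA.1.eigenvalues) : Matrix n n ℝ) = 1 := by
    rw [← Matrix.diagonal_one]
    congr 1
    ext i
    simp [hone i]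
  rw [hA.1.spectral_theorem, hdiag, map_one]

open scoped MatrixOrder in
/-- Positive definite matrices `M`, `N` with equal determinants
and `tr (M⁻¹ N) ≤ n` coincide. -/
theorem eq_of_posDef_of_trace_inv_mul_le {n : Type*} [Fintype n] [DecidableEq n]
    {M N : Matrix n n ℝ} (hM : M.PosDef) (hN : N.PosDef) (hdet : N.det = M.det)
    (htr : (M⁻¹ * N).trace ≤ Fintype.card n) : N = M := by
  -- With `M⁻¹ = B Bᴴ`, the product `M⁻¹ N`, not symmetric in general, is similar to the positive
  -- definite `Bᴴ N B`.
  obtain ⟨B, hB, hMB⟩ : ∃ B : Matrix n n ℝ, IsUnit B ∧ M⁻¹ = B * Bᴴ := by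
    obtain ⟨B, hB⟩ := CStarAlgebra.nonneg_iff_eq_mul_star_self.1 hM.inv.posSemidef.nonneg
    refine ⟨B, ?_, hB⟩
    have h := hM.inv.isUnit
    rw [hB, Matrix.isUnit_iff_isUnit_det, Matrix.det_mul] at h
    exact (Matrix.isUnit_iff_isUnit_det B).2 (isUnit_of_mul_isUnit_left h)
  have hBd : IsUnit B.det := (Matrix.isUnit_iff_isUnit_det B).1 hB
  have hMd := hM.det_pos
  have key : Bᴴ * N * B = 1 := by
    apply eq_one_of_posDef_of_det_eq_one
    · exact hN.conjTranspose_mul_mul_same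
        (Matrix.mulVec_injective_iff_isUnit.2 hB)
    · have h1 : (M⁻¹).det = B.det * Bᴴ.det := by rw [hMB, Matrix.det_mul]
      rw [Matrix.det_nonsing_inv, Ring.inverse_eq_inv'] at h1
      rw [Matrix.det_mul, Matrix.det_mul, hdet]
      have : B.det * Bᴴ.det * M.det = 1 := by rw [← h1]; field_simp
      linarith
    · rw [Matrix.trace_mul_cycle, ← hMB]
      exact htr
  have h2 : M⁻¹ * N = 1 := by
    have h3 : B * (Bᴴ * N * B) * B⁻¹ = 1 := by
      rw [key, mul_one, Matrix.mul_nonsing_inv _ hBd]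
    rw [← h3, hMB]
    simp only [Matrix.mul_assoc, Matrix.mul_nonsing_inv _ hBd, mul_one]
  have := congrArg (M * ·) h2
  simpa [← Matrix.mul_assoc, Matrix.mul_nonsing_inv _ hM.det_pos.ne'.isUnit] using this

/-- First order condition for a maximizer of the determinant on a segment. -/
theorem trace_inv_mul_le_of_det_le {n : Type*} [Fintype n] [DecidableEq n]
    {M N : Matrix n n ℝ} (hM : 0 < M.det)
    (h : ∀ t : ℝ, 0 < t → t ≤ 1 → ((1 - t) • M + t • N).det ≤ M.det) :
    (M⁻¹ * N).trace ≤ Fintype.card n := by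
  set K := M⁻¹ * N - 1 with hK
  have hMu : IsUnit M.det := hM.ne'.isUnit
  -- `det (1 + t K) = 1 + t tr K + t² p(t)`. Comparing with `1`, dividing by `t` and letting `t`
  -- decrease to `0` leaves `tr K ≤ 0`.
  set p := (Matrix.det (1 + (Polynomial.X : Polynomial ℝ) • K.map Polynomial.C)).divX.divX
  have hle : ∀ t : ℝ, 0 < t → t ≤ 1 → K.trace + p.eval t * t ≤ 0 := by
    intro t ht ht1
    have h1 : (1 - t) • M + t • N = M * (1 + t • K) := by
      rw [hK, mul_add, mul_one, Matrix.mul_smul, mul_sub, ← Matrix.mul_assoc,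
        Matrix.mul_nonsing_inv _ hMu, one_mul, mul_one, sub_smul, smul_sub, one_smul]
      abel
    have h2 := h t ht ht1
    rw [h1, Matrix.det_mul, Matrix.det_one_add_smul] at h2
    have h3 : t * (K.trace + p.eval t * t) ≤ 0 := by
      have := le_of_mul_le_mul_left (h2.trans_eq (mul_one _).symm) hM
      change 1 + K.trace * t + p.eval t * t ^ 2 ≤ 1 at this
      linarith
    exact nonpos_of_mul_nonpos_right h3 ht
  have hlim : Filter.Tendsto (fun t : ℝ => K.trace + p.eval t * t) (nhdsWithin 0 (Set.Ioi 0))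
      (nhds (K.trace + p.eval 0 * 0)) := by
    apply Filter.Tendsto.mono_left _ nhdsWithin_le_nhds
    apply Continuous.tendsto (f := fun t : ℝ => K.trace + p.eval t * t)
    fun_prop
  have hev : ∀ᶠ t in nhdsWithin (0 : ℝ) (Set.Ioi 0), K.trace + p.eval t * t ≤ 0 := by
    filter_upwards [Ioc_mem_nhdsGT (zero_lt_one' ℝ)] with t ht using hle t ht.1 ht.2
  have := le_of_tendsto hlim hev
  rw [hK, Matrix.trace_sub, Matrix.trace_one] at this
  linarith

/-! ### Chains of interval boundaries -/

/-- The inequalities `a 1 > a 2 ≥ a 3 > a 4 ≥ ⋯ > a (2 * r)`. -/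
structure IsChain (r : ℕ) (a : ℕ → ℝ) : Prop where
  gap : ∀ k, 1 ≤ k → k ≤ r → a (2 * k) < a (2 * k - 1)
  inner : ∀ k, 1 ≤ k → k < r → a (2 * k + 1) ≤ a (2 * k)

theorem IsChain.le {r : ℕ} {a : ℕ → ℝ} (h : IsChain r a) {i j : ℕ} (hi : 1 ≤ i) (hij : i ≤ j)
    (hj : j ≤ 2 * r) : a j ≤ a i := by
  induction j, hij using Nat.le_induction with
  | base => exact le_rfl
  | succ j hij ih =>
    refine le_trans ?_ (ih (by omega))
    rcases Nat.even_or_odd' j with ⟨k, rfl | rfl⟩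
    · exact h.inner k (by omega) (by omega)
    · have := h.gap (k + 1) (by omega) (by omega)
      exact this.le

/-- The complement of the support is the union of the gaps between the intervals. -/
theorem IsChain.notMem_supportSet_iff {r : ℕ} {a : ℕ → ℝ} (hr : 1 ≤ r) (h : IsChain r a) {x : ℝ} :
    x ∉ supportSet r a ↔ ∃ k, 1 ≤ k ∧ k ≤ r ∧ a (2 * k) < x ∧ x < a (2 * k - 1) := by
  simp only [supportSet, Set.mem_iUnion, Finset.mem_range, not_exists]
  constructor
  · intro hx
    have h0 : x < a 1 := by simpa [supportInterval] using hx 0 (by omega)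
    have hr' : a (2 * r) < x := by
      have := hx r (by omega)
      rw [supportInterval, if_neg (by omega), if_pos rfl] at this
      simpa using this
    -- The least such `k` is the right gap: by minimality `x ≤ a (2 * (k - 1))`, and since `x` is
    -- not in the interval `k - 1`, it lies below `a (2 * k - 1)`.
    have hex : ∃ k, 1 ≤ k ∧ a (2 * k) < x := ⟨r, hr, hr'⟩
    classical
    obtain ⟨hk1, hk⟩ := Nat.find_spec hex
    have hkr : Nat.find hex ≤ r := Nat.find_min' hex ⟨hr, hr'⟩
    have hmin := fun m => Nat.find_min hex (m := m)
    generalize Nat.find hex = k at *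
    refine ⟨k, hk1, hkr, hk, ?_⟩
    obtain rfl | hk2 := hk1.eq_or_lt
    · exact h0
    · have h1 := hmin (k - 1) (by omega)
      have h2 : x ≤ a (2 * (k - 1)) := by
        by_contra! hc
        exact h1 ⟨by omega, hc⟩
      have h3 := hx (k - 1) (by omega)
      rw [supportInterval, if_neg (by omega), if_neg (by omega)] at h3
      by_contra! hc
      refine h3 ⟨?_, h2⟩
      rwa [show 2 * (k - 1) + 1 = 2 * k - 1 by omega]
  · rintro ⟨k, hk1, hkr, hlo, hhi⟩ j hj hxj
    rw [supportInterval] at hxj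
    split_ifs at hxj with hj0 hjr
    · exact absurd (h.le le_rfl (by omega : 1 ≤ 2 * k - 1) (by omega))
        (not_le.2 (lt_of_le_of_lt hxj hhi))
    · exact absurd (h.le (by omega) (by omega : 2 * k ≤ 2 * r) le_rfl)
        (not_le.2 (lt_of_lt_of_le hlo hxj))
    · rcases lt_or_ge j k with hjk | hjk
      · exact absurd (h.le (by omega) (by omega : 2 * j + 1 ≤ 2 * k - 1) (by omega))
          (not_le.2 (lt_of_le_of_lt hxj.1 hhi))
      · exact absurd (h.le (by omega) (by omega : 2 * k ≤ 2 * j) (by omega))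
          (not_le.2 (lt_of_lt_of_le hlo hxj.2))

/-- A gap of one of two chains with the same gaps is a gap of the other. -/
theorem IsChain.exists_eq {r : ℕ} {a b : ℕ → ℝ} (hr : 1 ≤ r) (ha : IsChain r a)
    (hb : IsChain r b) (h : supportSet r a = supportSet r b) {k : ℕ} (hk1 : 1 ≤ k) (hkr : k ≤ r) :
    ∃ j, 1 ≤ j ∧ j ≤ r ∧ a (2 * k) = b (2 * j) ∧ a (2 * k - 1) = b (2 * j - 1) := by
  have hU : ∀ x, (∃ k, 1 ≤ k ∧ k ≤ r ∧ a (2 * k) < x ∧ x < a (2 * k - 1)) ↔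
      ∃ k, 1 ≤ k ∧ k ≤ r ∧ b (2 * k) < x ∧ x < b (2 * k - 1) := fun x => by
    rw [← ha.notMem_supportSet_iff hr, ← hb.notMem_supportSet_iff hr, h]
  -- No boundary lies in a gap of its own chain. Two gaps with a common point `m` thus have equal
  -- endpoints: otherwise an endpoint of one would lie inside the other.
  have hend : ∀ c : ℕ → ℝ, IsChain r c → ∀ i, 1 ≤ i → i ≤ 2 * r →
      ¬ ∃ k, 1 ≤ k ∧ k ≤ r ∧ c (2 * k) < c i ∧ c i < c (2 * k - 1) := by
    rintro c hc i hi1 hi2 ⟨k, hk1, hkr, h1, h2⟩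
    rcases le_or_gt (2 * k) i with hik | hik
    · exact absurd (hc.le (by omega) hik hi2) (not_le.2 h1)
    · exact absurd (hc.le hi1 (by omega : i ≤ 2 * k - 1) (by omega)) (not_le.2 h2)
  obtain ⟨m, hm1, hm2⟩ := exists_between (ha.gap k hk1 hkr)
  obtain ⟨j, hj1, hjr, hj2, hj3⟩ := (hU m).1 ⟨k, hk1, hkr, hm1, hm2⟩
  have A1 := fun hh => hend a ha (2 * k) (by omega) (by omega) ((hU _).2 hh)
  have A2 := fun hh => hend a ha (2 * k - 1) (by omega) (by omega) ((hU _).2 hh)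
  have B1 := fun hh => hend b hb (2 * j) (by omega) (by omega) ((hU _).1 hh)
  have B2 := fun hh => hend b hb (2 * j - 1) (by omega) (by omega) ((hU _).1 hh)
  refine ⟨j, hj1, hjr, ?_, ?_⟩
  · apply le_antisymm
    · by_contra! hc
      exact A1 ⟨j, hj1, hjr, hc, hm1.trans hj3⟩
    · by_contra! hc
      exact B1 ⟨k, hk1, hkr, hc, hj2.trans hm2⟩
  · apply le_antisymm
    · by_contra! hc
      exact B2 ⟨k, hk1, hkr, hm1.trans hj3, hc⟩
    · by_contra! hc
      exact A2 ⟨j, hj1, hjr, hj2.trans hm2, hc⟩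

/-- The boundaries are determined by the support and the number of intervals. -/
theorem IsChain.eq_of_supportSet_eq {r : ℕ} {a b : ℕ → ℝ} (hr : 1 ≤ r) (ha : IsChain r a)
    (hb : IsChain r b) (h : supportSet r a = supportSet r b) {k : ℕ} (hk1 : 1 ≤ k)
    (hkr : k ≤ 2 * r) : a k = b k := by
  -- Boundaries of one parity are strictly decreasing, even where an inner interval is a single
  -- point. Strictly monotone sequences on `Fin r` with the same range coincide, so each parity is
  -- treated separately.
  have hmono : ∀ c : ℕ → ℝ, IsChain r c → StrictMono fun i : Fin r => -c (2 * (i + 1) - 1) := by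
    intro c hc i j hij
    have hij' : (i : ℕ) < j := hij
    have h1 := hc.gap (i + 1) (by omega) (by omega)
    have h2 := hc.le (by omega) (by omega : 2 * ((i : ℕ) + 1) ≤ 2 * (j + 1) - 1) (by omega)
    exact neg_lt_neg (h2.trans_lt h1)
  have hmono' : ∀ c : ℕ → ℝ, IsChain r c → StrictMono fun i : Fin r => -c (2 * (i + 1)) := by
    intro c hc i j hij
    have hij' : (i : ℕ) < j := hij
    have h1 := hc.gap (j + 1) (by omega) (by omega)
    have h2 := hc.le (by omega) (by omega : 2 * ((i : ℕ) + 1) ≤ 2 * (j + 1) - 1) (by omega)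
    exact neg_lt_neg (h1.trans_le h2)
  have hsub : ∀ c d : ℕ → ℝ, IsChain r c → IsChain r d → supportSet r c = supportSet r d →
      (Set.range fun i : Fin r => -c (2 * (i + 1) - 1)) ⊆
        Set.range fun i : Fin r => -d (2 * (i + 1) - 1) := by
    rintro c d hc hd hcd _ ⟨i, rfl⟩
    obtain ⟨j, hj1, hjr, -, hj⟩ := hc.exists_eq hr hd hcd (k := i + 1) (by omega) (by omega)
    refine ⟨⟨j - 1, by omega⟩, ?_⟩
    simp only [hj, Nat.sub_add_cancel hj1]
  have hsub' : ∀ c d : ℕ → ℝ, IsChain r c → IsChain r d → supportSet r c = supportSet r d →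
      (Set.range fun i : Fin r => -c (2 * (i + 1))) ⊆
        Set.range fun i : Fin r => -d (2 * (i + 1)) := by
    rintro c d hc hd hcd _ ⟨i, rfl⟩
    obtain ⟨j, hj1, hjr, hj, -⟩ := hc.exists_eq hr hd hcd (k := i + 1) (by omega) (by omega)
    refine ⟨⟨j - 1, by omega⟩, ?_⟩
    simp only [hj, Nat.sub_add_cancel hj1]
  rcases Nat.even_or_odd' k with ⟨i, rfl | rfl⟩
  · have := congrFun ((hmono' a ha).range_inj (hmono' b hb) |>.1
      ((hsub' a b ha hb h).antisymm (hsub' b a hb ha h.symm))) ⟨i - 1, by omega⟩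
    simpa [Nat.sub_add_cancel (by omega : 1 ≤ i)] using this
  · have := congrFun ((hmono a ha).range_inj (hmono b hb) |>.1
      ((hsub a b ha hb h).antisymm (hsub b a hb ha h.symm))) ⟨i, by omega⟩
    simpa [show 2 * (i + 1) - 1 = 2 * i + 1 by omega] using this

/-- A support that is symmetric about `0` has symmetric boundaries. -/
theorem IsChain.symmetric {r : ℕ} {a : ℕ → ℝ} (hr : 1 ≤ r) (ha : IsChain r a)
    (h : ∀ x, x ∈ supportSet r a ↔ -x ∈ supportSet r a) {k : ℕ} (hk1 : 1 ≤ k) (hkr : k ≤ 2 * r) :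
    a (2 * r + 1 - k) = -a k := by
  -- Reflecting the support reverses and negates the chain; uniqueness of the boundaries then gives
  -- the claim.
  have hb : IsChain r fun i => -a (2 * r + 1 - i) := by
    constructor
    · intro k hk1 hkr
      have := ha.gap (r + 1 - k) (by omega) (by omega)
      rw [show 2 * (r + 1 - k) - 1 = 2 * r + 1 - 2 * k by omega,
        show 2 * (r + 1 - k) = 2 * r + 1 - (2 * k - 1) by omega] at this
      exact neg_lt_neg this
    · intro k hk1 hkr
      have := ha.inner (r - k) (by omega) (by omega)
      rw [show 2 * (r - k) + 1 = 2 * r + 1 - 2 * k by omega,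
        show 2 * (r - k) = 2 * r + 1 - (2 * k + 1) by omega] at this
      exact neg_le_neg this
  have hset : supportSet r a = supportSet r fun i => -a (2 * r + 1 - i) := by
    ext x
    rw [← not_iff_not, h x, ha.notMem_supportSet_iff hr, hb.notMem_supportSet_iff hr]
    constructor <;> rintro ⟨k, hk1, hkr, h1, h2⟩ <;>
      refine ⟨r + 1 - k, by omega, by omega, ?_, ?_⟩
    · rw [show 2 * r + 1 - 2 * (r + 1 - k) = 2 * k - 1 by omega]; linarith
    · rw [show 2 * r + 1 - (2 * (r + 1 - k) - 1) = 2 * k by omega]; linarith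
    · rw [show 2 * (r + 1 - k) = 2 * r + 1 - (2 * k - 1) by omega]; linarith
    · rw [show 2 * (r + 1 - k) - 1 = 2 * r + 1 - 2 * k by omega]; linarith
  have := ha.eq_of_supportSet_eq hr hb hset hk1 hkr
  linarith

/-- Symmetric boundaries yield symmetric intervals. -/
theorem supportInterval_sub_eq_neg {r : ℕ} {a : ℕ → ℝ} (hr : 1 ≤ r)
    (h : ∀ k, 1 ≤ k → k ≤ 2 * r → a (2 * r + 1 - k) = -a k) {k : ℕ} (hk : k ≤ r) :
    supportInterval r a (r - k) = -supportInterval r a k := by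
  obtain rfl | hk0 := Nat.eq_zero_or_pos k
  · have := h 1 le_rfl (by omega)
    simp only [Nat.add_sub_cancel] at this
    simp [supportInterval, this, show r ≠ 0 by omega]
  obtain rfl | hkr := hk.eq_or_lt
  · have := h 1 le_rfl (by omega)
    simp only [Nat.add_sub_cancel] at this
    simp [supportInterval, this, show k ≠ 0 by omega]
  · have h1 := h (2 * k) (by omega) (by omega)
    have h2 := h (2 * k + 1) (by omega) (by omega)
    rw [show 2 * r + 1 - 2 * k = 2 * (r - k) + 1 by omega] at h1
    rw [show 2 * r + 1 - (2 * k + 1) = 2 * (r - k) by omega] at h2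
    simp only [supportInterval]
    rw [if_neg (by omega), if_neg (by omega), if_neg (by omega), if_neg (by omega), h1, h2,
      Set.neg_Icc]

/-! ### Negativity intervals of a polynomial -/

/-- To the right of a point where `g` is negative there is a first zero of `g`. -/
theorem exists_first_zero_right {g : ℝ → ℝ} (hg : Continuous g)
    (htop : ∀ᶠ x in Filter.atTop, 0 < g x) {x : ℝ} (hx : g x < 0) :
    ∃ c, x < c ∧ g c = 0 ∧ ∀ y, x ≤ y → y < c → g y < 0 := by
  set S := {y | x ≤ y ∧ 0 ≤ g y}
  have hcl : IsClosed S := isClosed_Ici.inter (isClosed_le continuous_const hg)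
  have hne : S.Nonempty := by
    obtain ⟨y, hy1, hy2⟩ := (htop.and (Filter.eventually_ge_atTop x)).exists
    exact ⟨y, hy2, hy1.le⟩
  have hbd : BddBelow S := ⟨x, fun y hy => hy.1⟩
  obtain ⟨hc1, hc2⟩ := hcl.csInf_mem hne hbd
  have hlt : ∀ y, x ≤ y → y < sInf S → g y < 0 := fun y hy1 hy2 => by
    by_contra! hc
    exact absurd (csInf_le hbd ⟨hy1, hc⟩) (not_le.2 hy2)
  obtain ⟨z, hz, hz0⟩ := intermediate_value_Icc hc1 hg.continuousOn ⟨hx.le, hc2⟩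
  have hzc : z = sInf S := le_antisymm hz.2 (csInf_le hbd ⟨hz.1, hz0.ge⟩)
  refine ⟨sInf S, lt_of_le_of_ne hc1 ?_, hzc ▸ hz0, hlt⟩
  intro h
  rw [← h] at hc2
  linarith

/-- A point where `g` is negative lies between two zeros of `g` between which `g` is negative. -/
theorem exists_gap {g : ℝ → ℝ} (hg : Continuous g) (htop : ∀ᶠ x in Filter.atTop, 0 < g x)
    (hbot : ∀ᶠ x in Filter.atBot, 0 < g x) {x : ℝ} (hx : g x < 0) :
    ∃ b c, b < x ∧ x < c ∧ g b = 0 ∧ g c = 0 ∧ ∀ y, b < y → y < c → g y < 0 := by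
  obtain ⟨c, hc, hc0, hc'⟩ := exists_first_zero_right hg htop hx
  obtain ⟨b, hb, hb0, hb'⟩ := exists_first_zero_right (g := fun y => g (-y)) (x := -x)
    (hg.comp continuous_neg) (Filter.tendsto_neg_atTop_atBot.eventually hbot) (by simpa using hx)
  refine ⟨-b, c, by linarith, hc, hb0, hc0, fun y hy1 hy2 => ?_⟩
  rcases le_total x y with h | h
  · exact hc' y h hy2
  · simpa using hb' (-y) (by linarith) (by linarith)

/-- The set where a polynomial of degree at most `2 * q` is negative consists of at most `q` open
intervals. -/
theorem exists_isChain_of_polynomial {q : ℕ} {Q : Polynomial ℝ} (hdeg : Q.natDegree ≤ 2 * q)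
    (hneg : ∃ x, Q.eval x < 0) (htop : ∀ᶠ x in Filter.atTop, 0 < Q.eval x)
    (hbot : ∀ᶠ x in Filter.atBot, 0 < Q.eval x) :
    ∃ (r : ℕ) (a : ℕ → ℝ), 1 ≤ r ∧ r ≤ q ∧
      (∀ k, 1 ≤ k → k ≤ r → a (2 * k) < a (2 * k - 1)) ∧
      (∀ k, 1 ≤ k → k < r → a (2 * k + 1) ≤ a (2 * k)) ∧
      ∀ x, Q.eval x < 0 ↔ ∃ k, 1 ≤ k ∧ k ≤ r ∧ a (2 * k) < x ∧ x < a (2 * k - 1) := by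
  classical
  have hcont : Continuous fun x => Q.eval x := Q.continuous
  have hQ0 : Q ≠ 0 := by
    rintro rfl
    simp at hneg
  -- The left endpoints of the components of `{Q < 0}`; `c b` below is the matching right endpoint.
  set L : Finset ℝ := Q.roots.toFinset.filter fun b =>
    ∃ c, b < c ∧ Q.eval c = 0 ∧ ∀ y, b < y → y < c → Q.eval y < 0 with hLdef
  have hL : ∀ b, b ∈ L ↔ Q.eval b = 0 ∧
      ∃ c, b < c ∧ Q.eval c = 0 ∧ ∀ y, b < y → y < c → Q.eval y < 0 := by
    intro b
    simp [hLdef, hQ0]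
  choose! c hbc hc0 hcneg using fun b (hb : b ∈ L) => ((hL b).1 hb).2
  have hb0 : ∀ b ∈ L, Q.eval b = 0 := fun b hb => ((hL b).1 hb).1
  have hcover : ∀ x, Q.eval x < 0 → ∃ b ∈ L, b < x ∧ x < c b := by
    intro x hx
    obtain ⟨b, d, hbx, hxd, h1, h2, h3⟩ := exists_gap hcont htop hbot hx
    have hbL : b ∈ L := (hL b).2 ⟨h1, d, hbx.trans hxd, h2, h3⟩
    refine ⟨b, hbL, hbx, ?_⟩
    by_contra! hc
    exact (h3 (c b) (hbc b hbL) (hc.trans_lt hxd)).ne (hc0 b hbL)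
  have hsep : ∀ b ∈ L, ∀ b' ∈ L, b < b' → c b ≤ b' := by
    intro b hb b' hb' hlt
    by_contra! hc
    exact (hcneg b hb b' hlt hc).ne (hb0 b' hb')
  have hinj : ∀ b ∈ L, ∀ b' ∈ L, ∀ z, b < z → z < c b → b' < z → z < c b' → b = b' := by
    intro b hb b' hb' z h1 h2 h3 h4
    rcases lt_trichotomy b b' with h | h | h
    · linarith [hsep b hb b' hb' h]
    · exact h
    · linarith [hsep b' hb' b hb h]
  have hLne : L.Nonempty := by
    obtain ⟨x, hx⟩ := hneg
    obtain ⟨b, hb, -⟩ := hcover x hx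
    exact ⟨b, hb⟩
  have hcard : L.card ≤ q := by
    have hmid : ∀ b ∈ L, Q.eval ((b + c b) / 2) < 0 := fun b hb =>
      hcneg b hb _ (by linarith [hbc b hb]) (by linarith [hbc b hb])
    -- Counting zeros of `Q` would not suffice, since adjacent gaps may share an endpoint. A level
    -- `t < 0` above all midpoint values is attained on both sides of the midpoint in each gap,
    -- which gives `2 * L.card` distinct roots of `Q - t`.
    obtain ⟨t, ht, ht0⟩ : ∃ t : ℝ, (∀ b ∈ L, Q.eval ((b + c b) / 2) < t) ∧ t < 0 := by
      have h1 : ∀ᶠ t in nhdsWithin (0 : ℝ) (Set.Iio 0), ∀ b ∈ L, Q.eval ((b + c b) / 2) < t := by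
        rw [Filter.eventually_all_finset]
        intro b hb
        exact nhdsWithin_le_nhds (Ioi_mem_nhds (hmid b hb))
      exact (h1.and self_mem_nhdsWithin).exists
    have hx : ∀ b ∈ L, ∃ x, b < x ∧ x < (b + c b) / 2 ∧ Q.eval x = t := by
      intro b hb
      obtain ⟨x, hx, hxt⟩ := intermediate_value_Ioo' (f := fun x => Q.eval x)
        (by linarith [hbc b hb] : b ≤ (b + c b) / 2) hcont.continuousOn
        ⟨ht b hb, by rw [hb0 b hb]; exact ht0⟩
      exact ⟨x, hx.1, hx.2, hxt⟩
    have hy : ∀ b ∈ L, ∃ y, (b + c b) / 2 < y ∧ y < c b ∧ Q.eval y = t := by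
      intro b hb
      obtain ⟨x, hx, hxt⟩ := intermediate_value_Ioo (f := fun x => Q.eval x)
        (by linarith [hbc b hb] : (b + c b) / 2 ≤ c b) hcont.continuousOn
        ⟨ht b hb, by rw [hc0 b hb]; exact ht0⟩
      exact ⟨x, hx.1, hx.2, hxt⟩
    choose! u hu1 hu2 hut using hx
    choose! v hv1 hv2 hvt using hy
    have hu3 : ∀ b ∈ L, u b < c b := fun b hb => by linarith [hu2 b hb, hbc b hb]
    have hv3 : ∀ b ∈ L, b < v b := fun b hb => by linarith [hv1 b hb, hbc b hb]
    have hne : Q - Polynomial.C t ≠ 0 := by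
      intro h
      obtain ⟨b, hb⟩ := hLne
      have := congrArg (Polynomial.eval b) h
      simp [hb0 b hb] at this
      linarith
    have hdisj : Disjoint (L.image u) (L.image v) := by
      rw [Finset.disjoint_left]
      intro z hz1 hz2
      obtain ⟨b, hb, rfl⟩ := Finset.mem_image.1 hz1
      obtain ⟨b', hb', h⟩ := Finset.mem_image.1 hz2
      have h1 := hv3 b' hb'
      have h2 := hv2 b' hb'
      rw [h] at h1 h2
      obtain rfl := hinj b hb b' hb' (u b) (hu1 b hb) (hu3 b hb) h1 h2
      linarith [hu2 b hb, hv1 b hb]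
    have hsub : L.image u ∪ L.image v ⊆ (Q - Polynomial.C t).roots.toFinset := by
      intro z hz
      rw [Multiset.mem_toFinset, Polynomial.mem_roots hne, Polynomial.IsRoot.def,
        Polynomial.eval_sub, Polynomial.eval_C, sub_eq_zero]
      rcases Finset.mem_union.1 hz with hz | hz <;> obtain ⟨b, hb, rfl⟩ := Finset.mem_image.1 hz
      · exact hut b hb
      · exact hvt b hb
    have hcu : (L.image u).card = L.card := Finset.card_image_of_injOn fun b hb b' hb' h =>
      hinj b hb b' hb' (u b) (hu1 b hb) (hu3 b hb) (h ▸ hu1 b' hb') (h ▸ hu3 b' hb')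
    have hcv : (L.image v).card = L.card := Finset.card_image_of_injOn fun b hb b' hb' h =>
      hinj b hb b' hb' (v b) (hv3 b hb) (hv2 b hb) (h ▸ hv3 b' hb') (h ▸ hv2 b' hb')
    have h1 := Finset.card_le_card hsub
    rw [Finset.card_union_of_disjoint hdisj, hcu, hcv] at h1
    have h2 := Multiset.toFinset_card_le (Q - Polynomial.C t).roots
    have h3 := Polynomial.card_roots' (Q - Polynomial.C t)
    rw [Polynomial.natDegree_sub_C] at h3
    omega
  set r := L.card with hr
  have hr1 : 1 ≤ r := hLne.card_pos
  set e := L.orderEmbOfFin hr.symm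
  have he : ∀ i, e i ∈ L := L.orderEmbOfFin_mem hr.symm
  -- `E` lists `L` increasingly from index `0`, whereas boundaries decrease, so gap `k` starts at `E
  -- (r - k)`. The default value is never used for `1 ≤ k ≤ r`.
  set E : ℕ → ℝ := fun n => if h : n < r then e ⟨n, h⟩ else 0 with hE
  have hEL : ∀ n, n < r → E n ∈ L := fun n hn => by
    simp only [hE, dif_pos hn]; exact he _
  have hElt : ∀ n, n + 1 < r → E n < E (n + 1) := fun n hn => by
    simp only [hE, dif_pos hn, dif_pos (Nat.lt_of_succ_lt hn)]
    exact e.strictMono (by simp)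
  have hEsurj : ∀ b ∈ L, ∃ n, n < r ∧ E n = b := by
    intro b hb
    have : b ∈ Set.range e := by rw [L.range_orderEmbOfFin hr.symm]; exact hb
    obtain ⟨i, rfl⟩ := this
    exact ⟨i, i.2, by simp [hE]⟩
  set a : ℕ → ℝ := fun n => if n % 2 = 0 then E (r - n / 2) else c (E (r - (n + 1) / 2)) with ha
  have hae : ∀ k, a (2 * k) = E (r - k) := fun k => by simp [ha]
  have hao : ∀ k, 1 ≤ k → a (2 * k - 1) = c (E (r - k)) := fun k hk => by
    simp only [ha]
    rw [if_neg (by omega), show 2 * k - 1 + 1 = 2 * k by omega, Nat.mul_div_cancel_left _ two_pos]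
  refine ⟨r, a, hr1, hcard, ?_, ?_, ?_⟩
  · intro k hk1 hkr
    rw [hae, hao k hk1]
    exact hbc _ (hEL _ (by omega))
  · intro k hk1 hkr
    rw [hae, show 2 * k + 1 = 2 * (k + 1) - 1 by omega, hao _ (by omega)]
    have h := hElt (r - (k + 1)) (by omega)
    rw [show r - (k + 1) + 1 = r - k by omega] at h
    exact hsep _ (hEL _ (by omega)) _ (hEL _ (by omega)) h
  · intro x
    constructor
    · intro hx
      obtain ⟨b, hb, h1, h2⟩ := hcover x hx
      obtain ⟨n, hn, rfl⟩ := hEsurj b hb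
      refine ⟨r - n, by omega, by omega, ?_, ?_⟩
      · rwa [hae, show r - (r - n) = n by omega]
      · rwa [hao _ (by omega), show r - (r - n) = n by omega]
    · rintro ⟨k, hk1, hkr, h1, h2⟩
      rw [hae] at h1
      rw [hao k hk1] at h2
      exact hcneg _ (hEL _ (by omega)) x h1 h2

/-! ### Information matrices as integrals of polynomials -/

variable {q : ℕ} {fX f g : ℝ → ℝ} {α : ℝ}

/-- The polynomial `x ↦ f(x)ᵀ A f(x)`. -/
noncomputable def quadraticPolynomial (A : Matrix (Fin (q + 1)) (Fin (q + 1)) ℝ) : Polynomial ℝ :=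
  ∑ i, ∑ j, Polynomial.C (A i j) * Polynomial.X ^ ((i : ℕ) + (j : ℕ))

theorem eval_quadraticPolynomial (A : Matrix (Fin (q + 1)) (Fin (q + 1)) ℝ) (x : ℝ) :
    (quadraticPolynomial A).eval x = regressionVector q x ⬝ᵥ (A *ᵥ regressionVector q x) := by
  simp only [quadraticPolynomial, Polynomial.eval_finsetSum, Polynomial.eval_mul,
    Polynomial.eval_C, Polynomial.eval_pow, Polynomial.eval_X, dotProduct, Matrix.mulVec,
    regressionVector, Finset.mul_sum]
  exact Finset.sum_congr rfl fun i _ => Finset.sum_congr rfl fun j _ => by ring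

theorem natDegree_quadraticPolynomial_le (A : Matrix (Fin (q + 1)) (Fin (q + 1)) ℝ) :
    (quadraticPolynomial A).natDegree ≤ 2 * q := by
  refine Polynomial.natDegree_sum_le_of_forall_le _ _ fun i _ =>
    Polynomial.natDegree_sum_le_of_forall_le _ _ fun j _ => ?_
  exact (Polynomial.natDegree_C_mul_X_pow_le _ _).trans (by omega)

theorem coeff_quadraticPolynomial (A : Matrix (Fin (q + 1)) (Fin (q + 1)) ℝ) :
    (quadraticPolynomial A).coeff (2 * q) = A (Fin.last q) (Fin.last q) := by
  simp only [quadraticPolynomial, Polynomial.finsetSum_coeff, Polynomial.coeff_C_mul,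
    Polynomial.coeff_X_pow]
  rw [Finset.sum_eq_single (Fin.last q), Finset.sum_eq_single (Fin.last q)]
  · simp [two_mul]
  · intro j _ hj
    rw [Ne, Fin.ext_iff, Fin.val_last] at hj
    rw [Fin.val_last, if_neg (by omega), mul_zero]
  · simp
  · intro i _ hi
    rw [Ne, Fin.ext_iff, Fin.val_last] at hi
    refine Finset.sum_eq_zero fun j _ => ?_
    rw [if_neg (by omega), mul_zero]
  · simp

/-- A nonzero polynomial vanishes on a null set only. -/
theorem ae_eval_ne_zero {P : Polynomial ℝ} (hP : P ≠ 0) : ∀ᵐ x : ℝ, P.eval x ≠ 0 := by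
  rw [ae_iff]
  refine Set.Finite.measure_zero ?_ _
  refine (P.roots.toFinset.finite_toSet).subset fun x hx => ?_
  simpa [hP] using hx

theorem IsCovariateDensity.integrable (h : IsCovariateDensity q fX) : Integrable fX := by
  by_contra hc
  have := h.integral_eq_one
  -- The integral of a nonintegrable function is `0` by convention, so total mass `1` already forces
  -- integrability.
  rw [integral_undef hc] at this
  exact zero_ne_one this

/-- Domination by `(1 + x ^ (2 * q)) * fX x`, according to whether `|x| ≤ 1` or not. -/
theorem IsCovariateDensity.integrable_pow_mul (h : IsCovariateDensity q fX)
    (hg : Measurable g) (hg0 : ∀ x, 0 ≤ g x) (hle : ∀ x, g x ≤ fX x) {m : ℕ} (hm : m ≤ 2 * q) :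
    Integrable fun x => x ^ m * g x := by
  refine Integrable.mono' (h.integrable.add h.integrable_moment)
    ((measurable_id.pow_const m).mul hg).aestronglyMeasurable (Filter.Eventually.of_forall ?_)
  intro x
  have h1 : |x| ^ m ≤ 1 + x ^ (2 * q) := by
    have h2 : |x| ^ (2 * q) = x ^ (2 * q) := (even_two_mul q).pow_abs x
    rcases le_total |x| 1 with hx | hx
    · have := pow_le_one₀ (n := m) (abs_nonneg x) hx
      have : 0 ≤ x ^ (2 * q) := (even_two_mul q).pow_nonneg x
      linarith
    · have := pow_le_pow_right₀ hx hm
      linarith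
  have h3 : ‖x ^ m * g x‖ = |x| ^ m * g x := by
    rw [Real.norm_eq_abs, abs_mul, abs_pow, abs_of_nonneg (hg0 x)]
  rw [h3]
  calc |x| ^ m * g x ≤ (1 + x ^ (2 * q)) * fX x :=
        mul_le_mul h1 (hle x) (hg0 x) (le_trans (by positivity) h1)
    _ = fX x + x ^ (2 * q) * fX x := by ring

theorem IsSubsamplingDesign.integrable_pow_mul (hg : IsSubsamplingDesign fX α g)
    (h : IsCovariateDensity q fX) {m : ℕ} (hm : m ≤ 2 * q) :
    Integrable fun x => x ^ m * g x :=
  h.integrable_pow_mul hg.measurable hg.nonneg hg.le_covariate hm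

theorem IsSubsamplingDesign.integrable (hg : IsSubsamplingDesign fX α g)
    (h : IsCovariateDensity q fX) : Integrable g := by
  simpa using hg.integrable_pow_mul h (Nat.zero_le _)

theorem IsSubsamplingDesign.integrable_eval_mul (hg : IsSubsamplingDesign fX α g)
    (h : IsCovariateDensity q fX) {P : Polynomial ℝ} (hP : P.natDegree ≤ 2 * q) :
    Integrable fun x => P.eval x * g x := by
  simp_rw [Polynomial.eval_eq_sum_range, Finset.sum_mul, mul_assoc]
  refine integrable_finsetSum _ fun i hi => (hg.integrable_pow_mul h ?_).const_mul _
  rw [Finset.mem_range] at hi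
  omega

theorem IsSubsamplingDesign.integrable_entry (hg : IsSubsamplingDesign fX α g)
    (h : IsCovariateDensity q fX) (i j : Fin (q + 1)) :
    Integrable fun x => regressionVector q x i * regressionVector q x j * g x := by
  simp only [regressionVector, ← pow_add]
  exact hg.integrable_pow_mul h (by omega)

/-- `tr (A M(ξ)) = ∫ f(x)ᵀ A f(x) f_ξ(x) dx`. -/
theorem IsSubsamplingDesign.integral_quadraticPolynomial (hg : IsSubsamplingDesign fX α g)
    (h : IsCovariateDensity q fX) (A : Matrix (Fin (q + 1)) (Fin (q + 1)) ℝ) :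
    ∫ x, (quadraticPolynomial A).eval x * g x = (A * informationMatrix q g).trace := by
  have h1 : ∀ x, (quadraticPolynomial A).eval x * g x =
      ∑ i, ∑ j, A i j * (regressionVector q x j * regressionVector q x i * g x) := by
    intro x
    simp only [eval_quadraticPolynomial, dotProduct, Matrix.mulVec, Finset.mul_sum, Finset.sum_mul]
    exact Finset.sum_congr rfl fun i _ => Finset.sum_congr rfl fun j _ => by ring
  have h2 : ∀ i j, Integrable fun x =>
      A i j * (regressionVector q x j * regressionVector q x i * g x) :=
    fun i j => (hg.integrable_entry h j i).const_mul _
  simp_rw [h1]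
  rw [integral_finsetSum _ fun i _ => integrable_finsetSum _ fun j _ => h2 i j]
  simp only [Matrix.trace, Matrix.diag, Matrix.mul_apply]
  refine Finset.sum_congr rfl fun i _ => ?_
  rw [integral_finsetSum _ fun j _ => h2 i j]
  exact Finset.sum_congr rfl fun j _ => by rw [integral_const_mul]; rfl

/-- If `P` is the polynomial with coefficients `v`, then `vᵀ M v = ∫ P² g`. As `P` has finitely many
zeros, this vanishes only if `g = 0` almost everywhere, against the mass `α > 0`. -/
theorem IsSubsamplingDesign.posDef (hg : IsSubsamplingDesign fX α g)
    (h : IsCovariateDensity q fX) (hα : 0 < α) : (informationMatrix q g).PosDef := by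
  refine Matrix.PosDef.of_dotProduct_mulVec_pos ?_ fun v hv => ?_
  · ext i j
    simp only [Matrix.conjTranspose_apply, informationMatrix, Matrix.of_apply, star_trivial]
    simp_rw [mul_comm (regressionVector q _ j)]
  · set P : Polynomial ℝ := ∑ i : Fin (q + 1), Polynomial.C (v i) * Polynomial.X ^ (i : ℕ) with hPdef
    have hPc : ∀ j : Fin (q + 1), P.coeff j = v j := by
      intro j
      simp only [hPdef, Polynomial.finsetSum_coeff, Polynomial.coeff_C_mul,
        Polynomial.coeff_X_pow]
      rw [Finset.sum_eq_single j]
      · simp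
      · intro i _ hij
        rw [if_neg fun hc => hij (Fin.ext hc.symm), mul_zero]
      · simp
    have hP : P ≠ 0 := by
      intro h0
      apply hv
      ext j
      rw [← hPc, h0]
      simp
    have hPe : ∀ x, P.eval x = ∑ i, v i * regressionVector q x i := fun x => by
      simp [hPdef, Polynomial.eval_finsetSum, regressionVector]
    have hsq : ∀ x, (quadraticPolynomial (Matrix.vecMulVec v v)).eval x = P.eval x ^ 2 := by
      intro x
      rw [eval_quadraticPolynomial, hPe, sq, Finset.sum_mul_sum]
      simp only [dotProduct, Matrix.mulVec, Matrix.vecMulVec_apply, Finset.mul_sum]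
      exact Finset.sum_congr rfl fun i _ => Finset.sum_congr rfl fun j _ => by ring
    have hint := hg.integrable_eval_mul h
      (natDegree_quadraticPolynomial_le (Matrix.vecMulVec v v))
    have heq := hg.integral_quadraticPolynomial h (Matrix.vecMulVec v v)
    have htr : (Matrix.vecMulVec v v * informationMatrix q g).trace =
        star v ⬝ᵥ (informationMatrix q g *ᵥ v) := by
      rw [Matrix.vecMulVec_mul, Matrix.trace_vecMulVec, star_trivial, Matrix.dotProduct_mulVec,
        dotProduct_comm]
    rw [← htr, ← heq]
    simp_rw [hsq] at hint ⊢
    have hnn : ∀ x, 0 ≤ P.eval x ^ 2 * g x := fun x => mul_nonneg (sq_nonneg _) (hg.nonneg x)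
    refine lt_of_le_of_ne (integral_nonneg hnn) fun h0 => ?_
    have hz := (integral_eq_zero_iff_of_nonneg hnn hint).1 h0.symm
    have hg0 : g =ᵐ[volume] 0 := by
      filter_upwards [hz, ae_eval_ne_zero hP] with x hx1 hx2
      simpa [hx2] using hx1
    have := hg.integral_eq
    rw [integral_congr_ae hg0] at this
    simp at this
    linarith

/-! ### First order condition for optimal designs -/

theorem IsSubsamplingDesign.convexComb (hf : IsSubsamplingDesign fX α f)
    (hg : IsSubsamplingDesign fX α g) (h : IsCovariateDensity q fX) {t : ℝ} (ht0 : 0 ≤ t)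
    (ht1 : t ≤ 1) : IsSubsamplingDesign fX α fun x => (1 - t) * f x + t * g x where
  measurable := (hf.measurable.const_mul _).add (hg.measurable.const_mul _)
  nonneg x := add_nonneg (mul_nonneg (by linarith) (hf.nonneg x)) (mul_nonneg ht0 (hg.nonneg x))
  le_covariate x := by
    have h1 := mul_le_mul_of_nonneg_left (hf.le_covariate x) (by linarith : 0 ≤ 1 - t)
    have h2 := mul_le_mul_of_nonneg_left (hg.le_covariate x) ht0
    linarith
  integral_eq := by
    rw [integral_add ((hf.integrable h).const_mul _) ((hg.integrable h).const_mul _),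
      integral_const_mul, integral_const_mul, hf.integral_eq, hg.integral_eq]
    ring

theorem informationMatrix_convexComb (hf : IsSubsamplingDesign fX α f)
    (hg : IsSubsamplingDesign fX α g) (h : IsCovariateDensity q fX) (t : ℝ) :
    informationMatrix q (fun x => (1 - t) * f x + t * g x) =
      (1 - t) • informationMatrix q f + t • informationMatrix q g := by
  ext i j
  simp only [informationMatrix, Matrix.of_apply, Matrix.add_apply, Matrix.smul_apply, smul_eq_mul]
  rw [← integral_const_mul, ← integral_const_mul,
    ← integral_add ((hf.integrable_entry h i j).const_mul _)
      ((hg.integrable_entry h i j).const_mul _)]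
  exact integral_congr_ae (Filter.Eventually.of_forall fun x => by ring)

/-- First order condition: `tr (M(ξ*)⁻¹ M(ξ)) ≤ q + 1` for every design `ξ`. -/
theorem IsDOptimal.trace_le (hf : IsDOptimal q fX α f) (h : IsCovariateDensity q fX) (hα : 0 < α)
    (hg : IsSubsamplingDesign fX α g) :
    ((informationMatrix q f)⁻¹ * informationMatrix q g).trace ≤ Fintype.card (Fin (q + 1)) := by
  refine trace_inv_mul_le_of_det_le (hf.1.posDef h hα).det_pos fun t ht0 ht1 => ?_
  have hd := hf.1.convexComb hg h ht0.le ht1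
  rw [← informationMatrix_convexComb hf.1 hg h]
  -- Positivity of both determinants is needed here, as `Real.log` is monotone only on the positive
  -- reals.
  exact (Real.log_le_log_iff (hd.posDef h hα).det_pos (hf.1.posDef h hα).det_pos).1 (hf.2 _ hd)

/-- A `D`-optimal design maximizes the integral of its sensitivity function. -/
theorem IsDOptimal.integral_le (hf : IsDOptimal q fX α f) (h : IsCovariateDensity q fX)
    (hα : 0 < α) (hg : IsSubsamplingDesign fX α g) :
    ∫ x, (quadraticPolynomial (informationMatrix q f)⁻¹).eval x * g x ≤
      ∫ x, (quadraticPolynomial (informationMatrix q f)⁻¹).eval x * f x := by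
  rw [hg.integral_quadraticPolynomial h, hf.1.integral_quadraticPolynomial h,
    Matrix.nonsing_inv_mul _ (hf.1.posDef h hα).det_pos.ne'.isUnit, Matrix.trace_one]
  exact hf.trace_le h hα hg

/-! ### Invariance under reflection -/

/-- The signs `(-1) ^ j`, which turn `f(x)` into `f(-x)`. -/
noncomputable def signMatrix (q : ℕ) : Matrix (Fin (q + 1)) (Fin (q + 1)) ℝ :=
  Matrix.diagonal fun j => (-1) ^ (j : ℕ)

theorem signMatrix_mul_self (q : ℕ) : signMatrix q * signMatrix q = 1 := by
  rw [signMatrix, Matrix.diagonal_mul_diagonal, ← Matrix.diagonal_one]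
  congr 1
  ext j
  rw [← mul_pow]
  simp

theorem regressionVector_neg (q : ℕ) (x : ℝ) :
    regressionVector q (-x) = signMatrix q *ᵥ regressionVector q x := by
  ext j
  rw [signMatrix, Matrix.mulVec_diagonal, regressionVector, regressionVector, neg_pow]

theorem informationMatrix_comp_neg (q : ℕ) (f : ℝ → ℝ) :
    informationMatrix q (fun x => f (-x)) =
      signMatrix q * informationMatrix q f * signMatrix q := by
  ext i j
  rw [signMatrix, Matrix.mul_diagonal, Matrix.diagonal_mul]
  simp only [informationMatrix, Matrix.of_apply]
  rw [← integral_const_mul, ← integral_mul_const, ← integral_neg_eq_self]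
  refine integral_congr_ae (Filter.Eventually.of_forall fun x => ?_)
  simp only [regressionVector, neg_neg, neg_pow x]
  ring

/-- The information matrix of a `D`-optimal design is invariant under reflection. -/
theorem IsDOptimal.informationMatrix_symmetric (hf : IsDOptimal q fX α f)
    (h : IsCovariateDensity q fX) (hα : 0 < α) (hsymm : ∀ x, fX (-x) = fX x) :
    signMatrix q * informationMatrix q f * signMatrix q = informationMatrix q f := by
  have hg : IsSubsamplingDesign fX α fun x => f (-x) :=
    { measurable := hf.1.measurable.comp measurable_neg
      nonneg := fun x => hf.1.nonneg _
      le_covariate := fun x => (hf.1.le_covariate _).trans_eq (hsymm x)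
      integral_eq := by rw [integral_neg_eq_self f volume, hf.1.integral_eq] }
  have hS : (signMatrix q).det * (signMatrix q).det = 1 := by
    rw [← Matrix.det_mul, signMatrix_mul_self, Matrix.det_one]
  rw [← informationMatrix_comp_neg]
  -- The reflected design has the same determinant because `det S ^ 2 = 1` for the sign matrix `S`;
  -- the trace bound is the first order condition applied to it.
  refine eq_of_posDef_of_trace_inv_mul_le (hf.1.posDef h hα) (hg.posDef h hα) ?_
    (hf.trace_le h hα hg)
  rw [informationMatrix_comp_neg, Matrix.det_mul, Matrix.det_mul]
  linear_combination (informationMatrix q f).det * hS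

/-- Since `S = S⁻¹`, invariance of `M` under conjugation by `S` passes to `M⁻¹`, and `f(-x) = S
f(x)`. -/
theorem IsDOptimal.sensitivity_neg (hf : IsDOptimal q fX α f) (h : IsCovariateDensity q fX)
    (hα : 0 < α) (hsymm : ∀ x, fX (-x) = fX x) (x : ℝ) :
    sensitivity q α f (-x) = sensitivity q α f x := by
  have hS : (signMatrix q)⁻¹ = signMatrix q :=
    Matrix.inv_eq_left_inv (signMatrix_mul_self q)
  have hinv : signMatrix q * (informationMatrix q f)⁻¹ * signMatrix q =
      (informationMatrix q f)⁻¹ := by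
    conv_rhs => rw [← hf.informationMatrix_symmetric h hα hsymm]
    rw [Matrix.mul_inv_rev, Matrix.mul_inv_rev, hS, Matrix.mul_assoc]
  have hT : (signMatrix q)ᵀ = signMatrix q := Matrix.diagonal_transpose _
  rw [sensitivity, sensitivity, regressionVector_neg]
  conv_rhs => rw [← hinv]
  rw [← Matrix.mulVec_mulVec, ← Matrix.mulVec_mulVec,
    Matrix.dotProduct_mulVec _ (signMatrix q), ← Matrix.mulVec_transpose, hT]

/-! ### Threshold and equivalence theorem -/

/-- The superlevel sets of a nonconstant polynomial attain every intermediate mass. -/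
theorem exists_threshold_integral_eq {P : Polynomial ℝ} (hP : ∀ s : ℝ, P - Polynomial.C s ≠ 0)
    (hint : Integrable fX) (h1 : ∫ x, fX x = 1) (hα₀ : 0 < α) (hα₁ : α < 1) :
    ∃ s : ℝ, ∫ x, {x | s ≤ P.eval x}.indicator fX x = α := by
  have hmeas : ∀ s : ℝ, MeasurableSet {x | s ≤ P.eval x} := fun s =>
    measurableSet_le measurable_const P.continuous.measurable
  have hms : ∀ s : ℝ, AEStronglyMeasurable ({x | s ≤ P.eval x}.indicator fX) volume := fun s =>
    hint.aestronglyMeasurable.indicator (hmeas s)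
  have hbd : ∀ s : ℝ, ∀ᵐ x : ℝ, ‖{x | s ≤ P.eval x}.indicator fX x‖ ≤ ‖fX x‖ := fun s =>
    Filter.Eventually.of_forall fun x => norm_indicator_le_norm_self _ _
  -- The level set `{P = s}` is finite, hence null, so the integrand is continuous at `s` for almost
  -- every `x`, with dominating function `|fX|`.
  have hcont : Continuous fun s : ℝ => ∫ x, {x | s ≤ P.eval x}.indicator fX x := by
    rw [continuous_iff_continuousAt]
    intro s
    refine continuousAt_of_dominated (Filter.Eventually.of_forall hms)
      (Filter.Eventually.of_forall hbd) hint.norm ?_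
    filter_upwards [ae_eval_ne_zero (hP s)] with x hx
    rw [Polynomial.eval_sub, Polynomial.eval_C, sub_ne_zero] at hx
    rcases lt_or_gt_of_ne hx with h | h
    · refine (continuousAt_const (y := (0 : ℝ))).congr ?_
      filter_upwards [Ioi_mem_nhds h] with t ht
      exact (Set.indicator_of_notMem (s := {x | t ≤ P.eval x})
        (show ¬ t ≤ P.eval x from not_le.2 ht) fX).symm
    · refine (continuousAt_const (y := fX x)).congr ?_
      filter_upwards [Iio_mem_nhds h] with t ht
      exact (Set.indicator_of_mem (s := {x | t ≤ P.eval x})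
        (show t ≤ P.eval x from le_of_lt ht) fX).symm
  have htop : Filter.Tendsto (fun s : ℝ => ∫ x, {x | s ≤ P.eval x}.indicator fX x) Filter.atTop
      (nhds (∫ _ : ℝ, (0 : ℝ))) := by
    refine tendsto_integral_filter_of_dominated_convergence _ (Filter.Eventually.of_forall hms)
      (Filter.Eventually.of_forall hbd) hint.norm (Filter.Eventually.of_forall fun x => ?_)
    refine tendsto_const_nhds.congr' ?_
    filter_upwards [Filter.eventually_gt_atTop (P.eval x)] with t ht
    exact (Set.indicator_of_notMem (s := {x | t ≤ P.eval x})
        (show ¬ t ≤ P.eval x from not_le.2 ht) fX).symm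
  have hbot : Filter.Tendsto (fun s : ℝ => ∫ x, {x | s ≤ P.eval x}.indicator fX x) Filter.atBot
      (nhds (∫ x, fX x)) := by
    refine tendsto_integral_filter_of_dominated_convergence _ (Filter.Eventually.of_forall hms)
      (Filter.Eventually.of_forall hbd) hint.norm (Filter.Eventually.of_forall fun x => ?_)
    refine tendsto_const_nhds.congr' ?_
    filter_upwards [Filter.eventually_le_atBot (P.eval x)] with t ht
    exact (Set.indicator_of_mem (s := {x | t ≤ P.eval x}) ht fX).symm
  rw [integral_zero] at htop
  rw [h1] at hbot
  exact mem_range_of_exists_le_of_exists_ge hcont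
    ((htop.eventually (Iio_mem_nhds hα₀)).exists.imp fun _ h => le_of_lt h)
    ((hbot.eventually (Ioi_mem_nhds hα₁)).exists.imp fun _ h => le_of_lt h)

/-- A design that maximizes the integral of a nonconstant polynomial of degree at most `2 * q`
is the restriction of the covariate distribution to a superlevel set of that polynomial. -/
theorem IsSubsamplingDesign.exists_threshold (hf : IsSubsamplingDesign fX α f)
    (h : IsCovariateDensity q fX) (hα₀ : 0 < α) (hα₁ : α < 1) {P : Polynomial ℝ}
    (hdeg : P.natDegree ≤ 2 * q) (hP : ∀ s : ℝ, P - Polynomial.C s ≠ 0)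
    (hmax : ∀ g, IsSubsamplingDesign fX α g →
      ∫ x, P.eval x * g x ≤ ∫ x, P.eval x * f x) :
    ∃ s : ℝ, f =ᵐ[volume] {x | s ≤ P.eval x}.indicator fX := by
  obtain ⟨s, hs⟩ := exists_threshold_integral_eq hP h.integrable h.integral_eq_one hα₀ hα₁
  refine ⟨s, ?_⟩
  set g := {x | s ≤ P.eval x}.indicator fX with hgdef
  have hg : IsSubsamplingDesign fX α g :=
    { measurable := h.measurable.indicator
        (measurableSet_le measurable_const P.continuous.measurable)
      nonneg := fun x => Set.indicator_nonneg (fun x _ => h.nonneg x) x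
      le_covariate := fun x => Set.indicator_le_self' (fun x _ => h.nonneg x) x
      integral_eq := hs }
  -- Bathtub principle: `g` takes all available mass where `P ≥ s` and none elsewhere. Equal masses
  -- and maximality of `f` make the integral of this product nonpositive, so `g = f` almost
  -- everywhere off `{P = s}`.
  have hnn : ∀ x, 0 ≤ (P.eval x - s) * (g x - f x) := by
    intro x
    by_cases hx : s ≤ P.eval x
    · have : g x = fX x := Set.indicator_of_mem (s := {x | s ≤ P.eval x}) hx fX
      rw [this]
      exact mul_nonneg (sub_nonneg.2 hx) (sub_nonneg.2 (hf.le_covariate x))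
    · have : g x = 0 := Set.indicator_of_notMem (s := {x | s ≤ P.eval x}) hx fX
      rw [this]
      exact mul_nonneg_of_nonpos_of_nonpos (by linarith) (by linarith [hf.nonneg x])
  have hPg := hg.integrable_eval_mul h hdeg
  have hPf := hf.integrable_eval_mul h hdeg
  have hsg := (hg.integrable h).const_mul s
  have hsf := (hf.integrable h).const_mul s
  have hPgf : Integrable fun x => P.eval x * g x - P.eval x * f x := hPg.sub hPf
  have hsgf : Integrable fun x => s * g x - s * f x := hsg.sub hsf
  have hexp : (fun x => (P.eval x - s) * (g x - f x)) =
      fun x => (P.eval x * g x - P.eval x * f x) - (s * g x - s * f x) := by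
    ext x
    ring
  have hint : Integrable fun x => (P.eval x - s) * (g x - f x) := by
    rw [hexp]
    exact hPgf.sub hsgf
  have hle : ∫ x, (P.eval x - s) * (g x - f x) ≤ 0 := by
    rw [hexp, integral_sub hPgf hsgf, integral_sub hPg hPf,
      integral_sub hsg hsf, integral_const_mul, integral_const_mul, hg.integral_eq, hf.integral_eq]
    linarith [hmax g hg]
  have hz := (integral_eq_zero_iff_of_nonneg hnn hint).1 (le_antisymm hle (integral_nonneg hnn))
  filter_upwards [hz, ae_eval_ne_zero (hP s)] with x hx1 hx2
  rw [Polynomial.eval_sub, Polynomial.eval_C] at hx2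
  have := (mul_eq_zero.1 hx1).resolve_left hx2
  linarith

/-- The sensitivity function of a design is a polynomial of degree `2 * q` with positive leading
coefficient. -/
theorem IsSubsamplingDesign.exists_sensitivity_eq_eval (hf : IsSubsamplingDesign fX α f)
    (h : IsCovariateDensity q fX) (hα : 0 < α) :
    ∃ P : Polynomial ℝ, P = Polynomial.C α * quadraticPolynomial (informationMatrix q f)⁻¹ ∧
      (∀ x, sensitivity q α f x = P.eval x) ∧ P.natDegree = 2 * q ∧ 0 < P.leadingCoeff := by
  set P := Polynomial.C α * quadraticPolynomial (informationMatrix q f)⁻¹ with hP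
  have hle : P.natDegree ≤ 2 * q :=
    (Polynomial.natDegree_C_mul_le _ _).trans (natDegree_quadraticPolynomial_le _)
  have hc : 0 < P.coeff (2 * q) := by
    rw [hP, Polynomial.coeff_C_mul, coeff_quadraticPolynomial]
    exact mul_pos hα (hf.posDef h hα).inv.diag_pos
  have hd : P.natDegree = 2 * q := Polynomial.natDegree_eq_of_le_of_coeff_ne_zero hle hc.ne'
  refine ⟨P, rfl, fun x => ?_, hd, ?_⟩
  · rw [hP, Polynomial.eval_mul, Polynomial.eval_C, eval_quadraticPolynomial, sensitivity]
  · rwa [Polynomial.leadingCoeff, hd]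

/-- A polynomial of positive even degree with positive leading coefficient tends to infinity in
both directions. -/
theorem tendsto_atTop_of_natDegree_eq_two_mul {P : Polynomial ℝ} (hq : 1 ≤ q)
    (hd : P.natDegree = 2 * q) (hl : 0 < P.leadingCoeff) :
    Filter.Tendsto (fun x => P.eval x) Filter.atTop Filter.atTop ∧
      Filter.Tendsto (fun x => P.eval x) Filter.atBot Filter.atTop := by
  refine ⟨P.tendsto_atTop_of_leadingCoeff_nonneg
    (Polynomial.natDegree_pos_iff_degree_pos.1 (by omega)) hl.le, ?_⟩
  have hX : (-Polynomial.X : Polynomial ℝ).natDegree = 1 := by simp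
  have hd' : (P.comp (-Polynomial.X)).natDegree = 2 * q := by
    rw [Polynomial.natDegree_comp, hX, hd, mul_one]
  have hl' : (P.comp (-Polynomial.X)).leadingCoeff = P.leadingCoeff := by
    rw [Polynomial.leadingCoeff_comp (by rw [hX]; exact one_ne_zero), hd]
    simp
  have := (P.comp (-Polynomial.X)).tendsto_atTop_of_leadingCoeff_nonneg
    (Polynomial.natDegree_pos_iff_degree_pos.1 (by omega)) (hl' ▸ hl.le)
  have h2 := this.comp Filter.tendsto_neg_atBot_atTop
  simpa [Function.comp_def, Polynomial.eval_comp] using h2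

/-- Equivalence theorem: the support of a `D`-optimal design is a superlevel set of its sensitivity
function and a union of at most `q + 1` intervals. -/
theorem IsDOptimal.exists_hasBoundaries (hf : IsDOptimal q fX α f) (hq : 1 ≤ q) (hα₀ : 0 < α)
    (hα₁ : α < 1) (h : IsCovariateDensity q fX) :
    ∃ (s : ℝ) (r : ℕ) (a : ℕ → ℝ), HasBoundaries q fX α f s r a := by
  obtain ⟨P, hPdef, hψ, hd, hl⟩ := hf.1.exists_sensitivity_eq_eval h hα₀
  obtain ⟨htop, hbot⟩ := tendsto_atTop_of_natDegree_eq_two_mul hq hd hl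
  have hPs : ∀ s : ℝ, P - Polynomial.C s ≠ 0 := by
    intro s hs
    have := Polynomial.natDegree_sub_C (p := P) (a := s)
    rw [hs, Polynomial.natDegree_zero] at this
    omega
  obtain ⟨s, hs⟩ := hf.1.exists_threshold h hα₀ hα₁ hd.le hPs fun g hg => by
    simp only [hPdef, Polynomial.eval_mul, Polynomial.eval_C, mul_assoc, integral_const_mul]
    exact mul_le_mul_of_nonneg_left (hf.integral_le h hα₀ hg) hα₀.le
  -- Otherwise `f = fX` almost everywhere, with mass `1 > α`; this is what yields `r ≥ 1`.
  have hneg : ∃ x, (P - Polynomial.C s).eval x < 0 := by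
    by_contra! hc
    have huniv : {x | s ≤ P.eval x} = Set.univ := by
      ext x
      simpa using hc x
    rw [huniv, Set.indicator_univ] at hs
    have h1 := integral_congr_ae hs
    rw [hf.1.integral_eq, h.integral_eq_one] at h1
    exact hα₁.ne h1
  obtain ⟨r, a, hr1, hrq, hgap, hinner, hiff⟩ := exists_isChain_of_polynomial
    (Q := P - Polynomial.C s) (q := q) (by rw [Polynomial.natDegree_sub_C]; exact hd.le) hneg
    (by filter_upwards [htop.eventually_gt_atTop s] with x hx; simpa using hx)
    (by filter_upwards [hbot.eventually_gt_atTop s] with x hx; simpa using hx)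
  have hmem : ∀ x, x ∉ supportSet r a ↔ sensitivity q α f x < s := by
    intro x
    rw [IsChain.notMem_supportSet_iff hr1 ⟨hgap, hinner⟩, ← hiff, hψ]
    simp
  have hset : supportSet r a = {x | s ≤ P.eval x} := by
    ext x
    rw [← not_iff_not, hmem, hψ]
    simp
  exact ⟨s, r, a, hr1, hrq, hgap, hinner, hset ▸ hs,
    fun x hx => not_lt.1 fun hc => (hmem x).2 hc hx, fun x hx => (hmem x).1 hx⟩

end Subsampling

theorem mainTheorem3 (q : ℕ) (hq : 1 ≤ q) (α : ℝ) (hα₀ : 0 < α) (hα₁ : α < 1)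
    (fX : ℝ → ℝ) (hfX : Subsampling.IsCovariateDensity q fX)
    (hsymm : ∀ x, fX (-x) = fX x)
    (f : ℝ → ℝ) (hf : Subsampling.IsDOptimal q fX α f) :
    (∃ (s : ℝ) (r : ℕ) (a : ℕ → ℝ), Subsampling.HasBoundaries q fX α f s r a) ∧
      ∀ (s : ℝ) (r : ℕ) (a : ℕ → ℝ), Subsampling.HasBoundaries q fX α f s r a →
        (∀ k, 1 ≤ k → k ≤ 2 * r → a (2 * r + 1 - k) = -a k) ∧
        (∀ k, k ≤ r →
          Subsampling.supportInterval r a (r - k) = -Subsampling.supportInterval r a k) := by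
  refine ⟨hf.exists_hasBoundaries hq hα₀ hα₁ hfX, fun s r a hb => ?_⟩
  -- The two pointwise inequalities alone identify the support with `{ψ ≥ s}`, for any choice of
  -- `s`, `r` and `a`.
  have hmem : ∀ x, x ∈ Subsampling.supportSet r a ↔ s ≤ Subsampling.sensitivity q α f x := fun x =>
    ⟨hb.le_sensitivity x, fun hx => by_contra fun hc => not_lt.2 hx (hb.sensitivity_lt x hc)⟩
  have hset : ∀ x, x ∈ Subsampling.supportSet r a ↔ -x ∈ Subsampling.supportSet r a := fun x => by
    rw [hmem, hmem, hf.sensitivity_neg hfX hα₀ hsymm]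
  have hsym : ∀ k, 1 ≤ k → k ≤ 2 * r → a (2 * r + 1 - k) = -a k := fun k hk1 hkr =>
    Subsampling.IsChain.symmetric hb.one_le ⟨hb.gap, hb.inner⟩ hset hk1 hkr
  exact ⟨hsym, fun k hk => Subsampling.supportInterval_sub_eq_neg hb.one_le hsym hk⟩
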